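/- Let $k$ be a commutative ring with identity. A *regular Hom-Lie triple system* over $k$ is a $k$-module $T$ with a trilinear bracket $[\,,\,,]:T^3\to T$ and a bijective linear map $\alpha:T\to T$ such that $\alpha[a,b,c]=[\alpha a,\alpha b,\alpha c]$, $[a,a,b]=0$, $[a,b,c]+[b,c,a]+[c,a,b]=0$ and $$[\alpha a,\alpha b,[c,d,e]]=[[a,b,c],\alpha d,\alpha e]+[\alpha c,[a,b,d],\alpha e]+[\alpha c,\alpha d,[a,b,e]]$$ for all $a,b,c,d,e\in T$. Let $\mathcal{RLTS}$ be the category of these systems, whose morphisms are the linear maps that preserve the brackets and commute with the maps $\alpha$. Let $\mathcal{TL}_{\mathbb Z_2}$ be the category of pairs $(L,\alpha)$, where $L=L_0\oplus L_1$ is a $\mathbb Z_2$-graded Lie algebra over $k$ and $\alpha$ is a graded automorphism of $L$; its morphisms are the graded Lie algebra homomorphisms that commute with the automorphisms. For $T\in\mathcal{RLTS}$ put $D_{ab}(c)=[a,b,c]$, let $\lambda:T\wedge T\to \mathrm{End}(T)$ be the linear map with $\lambda(a\wedge b)=D_{ab}$, and let $X\in\mathrm{End}(T)$ act on $T\wedge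 T$ by $X\cdot(a\wedge b)=\alpha^{-1}Xa\wedge b+a\wedge\alpha^{-1}Xb$. Let $\langle T,T\rangle$ be the quotient of $T\wedge T$ by the span of all $\lambda(x)\cdot x$ with $x\in T\wedge T$, let $\langle a,b\rangle$ be the class of $a\wedge b$, and let $\mu:\langle T,T\rangle\to\mathrm{End}(T)$ be the map induced by $\lambda$. Then $U(T)=\langle T,T\rangle\oplus T$ is the $\mathbb Z_2$-graded Lie algebra with even part $\langle T,T\rangle$, odd part $T$ and bracket $$[X+a,Y+b]=\big([X,Y]+\langle a,b\rangle\big)+\big(\alpha^{-1}\mu(X)b-\alpha^{-1}\mu(Y)a\big),$$ where $[\langle a,b\rangle,\langle c,d\rangle]=\langle \alpha^{-1}[a,b,c],d\rangle+\langle c,\alpha^{-1}[a,b,d]\rangle$. It carries the graded automorphism $\alpha_U$ with $\alpha_U(a)=\alpha(a)$ and $\alpha_U(\langle a,b\rangle)=\langle\alpha a,\alpha b\rangle$. Let $\mathfrak A:\mathcal{RLTS}\to\mathcal{TL}_{\mathbb Z_2}$ be the functor that sends $T$ to $(U(T),\alpha_U)$ and a morphism $f:T\to S$ to the homomorphism with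 $a\mapsto f(a)$ and $\langle a,b\rangle\mapsto\langle f(a),f(b)\rangle$. A $\mathbb Z_2$-graded Lie algebra $L$ is *centrally 0-closed* if every central 0-extension of $L$ splits: for every surjective graded homomorphism $\pi:K\to L$ of $\mathbb Z_2$-graded Lie algebras whose kernel is central in $K$ and contained in $K_0$, there is a graded homomorphism $s:L\to K$ with $\pi\circ s=\mathrm{id}_L$. **Theorem.** The functor $\mathfrak A$ is full and faithful. It takes values in the full subcategory of $\mathcal{TL}_{\mathbb Z_2}$ of those pairs $(L,\alpha)$ for which $L$ is centrally 0-closed and is generated as a Lie algebra by its odd component $L_1$, and as a functor to this subcategory it is an equivalence of categories. In particular, $\mathcal{RLTS}$ is equivalent to the category of pairs $(L,\alpha)$ where $L$ is a centrally 0-closed $\mathbb Z_2$-graded Lie algebra generated by its odd component and $\alpha$ is a graded automorphism of $L$. -/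

import Mathlib

universe u v w

open CategoryTheory
open scoped TensorProduct

noncomputable section

/-- A Hom-Lie triple system structure on a `k`-module `T`: a trilinear bracket and two linear
twisting maps satisfying left skew symmetry, the cyclic identity and the ternary Hom-Nambu
identity. -/
structure HomLieTripleSystem (k : Type u) (T : Type v) [CommRing k] [AddCommGroup T]
    [Module k T] where
  bracket : T →ₗ[k] T →ₗ[k] T →ₗ[k] T
  twist₁ : T →ₗ[k] T
  twist₂ : T →ₗ[k] T
  bracket_self : ∀ a b, bracket a a b = 0
  bracket_cyclic : ∀ a b c, bracket a b c + bracket b c a + bracket c a b = 0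
  hom_nambu : ∀ a b c d e,
    bracket (twist₁ a) (twist₂ b) (bracket c d e) =
      bracket (bracket a b c) (twist₁ d) (twist₂ e)
        + bracket (twist₁ c) (bracket a b d) (twist₂ e)
        + bracket (twist₁ c) (twist₂ d) (bracket a b e)

namespace HomLieTripleSystem

variable {k : Type u} [CommRing k] {T : Type v} [AddCommGroup T] [Module k T]
  {S : Type w} [AddCommGroup S] [Module k S]

/-- A linear map is a Hom-LTS homomorphism if it respects the triple brackets and intertwines
both twisting maps. -/
structure IsHom (A : HomLieTripleSystem k T) (B : HomLieTripleSystem k S) (f : T →ₗ[k] S) :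
    Prop where
  map_bracket : ∀ a b c, B.bracket (f a) (f b) (f c) = f (A.bracket a b c)
  comm₁ : ∀ a, f (A.twist₁ a) = B.twist₁ (f a)
  comm₂ : ∀ a, f (A.twist₂ a) = B.twist₂ (f a)

/-- A Hom-LTS is regular if its two twisting maps coincide and are a Hom-LTS automorphism. -/
structure IsRegular (A : HomLieTripleSystem k T) : Prop where
  twist_eq : A.twist₁ = A.twist₂
  isHom : A.IsHom A A.twist₁
  bijective : Function.Bijective A.twist₁

end HomLieTripleSystem

/-! ### The category of regular Hom-Lie triple systems -/

/-- A regular Hom-Lie triple system over `k`. -/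
structure RLTS (k : Type u) [CommRing k] where
  carrier : Type v
  [addCommGroup : AddCommGroup carrier]
  [module : Module k carrier]
  str : HomLieTripleSystem k carrier
  regular : str.IsRegular

namespace RLTS

variable {k : Type u} [CommRing k]

instance : CoeSort (RLTS.{u, v} k) (Type v) := ⟨RLTS.carrier⟩

instance (T : RLTS.{u, v} k) : AddCommGroup T := T.addCommGroup
instance (T : RLTS.{u, v} k) : Module k T := T.module

/-- Morphisms of regular Hom-Lie triple systems are the Hom-LTS homomorphisms. -/
@[ext]
structure Hom (T S : RLTS.{u, v} k) where
  toLinearMap : T →ₗ[k] S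
  isHom : T.str.IsHom S.str toLinearMap

instance : Category (RLTS.{u, v} k) where
  Hom T S := Hom T S
  id T := ⟨LinearMap.id, ⟨fun _ _ _ => rfl, fun _ => rfl, fun _ => rfl⟩⟩
  comp f g := ⟨g.toLinearMap ∘ₗ f.toLinearMap,
    ⟨fun a b c => by simp [g.isHom.map_bracket, f.isHom.map_bracket],
     fun a => by simp [g.isHom.comm₁, f.isHom.comm₁],
     fun a => by simp [g.isHom.comm₂, f.isHom.comm₂]⟩⟩

variable (T : RLTS.{u, v} k)

/-- The twisting map `α` of a regular Hom-LTS, as a linear automorphism. -/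
def twist : T ≃ₗ[k] T := LinearEquiv.ofBijective T.str.twist₁ T.regular.bijective

/-- `D a b = [a, b, -]`, an endomorphism of `T` depending bilinearly on `a` and `b`. -/
def D : T →ₗ[k] T →ₗ[k] Module.End k T := T.str.bracket

/-- For `X ∈ End T`, the endomorphism `X^{α⁻¹} = α⁻¹ ∘ X`, as a linear map in `X`. -/
def untwist : Module.End k T →ₗ[k] Module.End k T :=
  LinearMap.llcomp k T T T T.twist.symm.toLinearMap

/-! ### The exterior square and its quotient `⟨T, T⟩` -/

/-- The submodule of `T ⊗ T` spanned by all `a ⊗ a`. -/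
def diag : Submodule k (T ⊗[k] T) := Submodule.span k (Set.range fun a : T => a ⊗ₜ[k] a)

/-- The exterior square `T ∧ T`. -/
abbrev Wedge : Type v := (T ⊗[k] T) ⧸ T.diag

/-- The element `a ∧ b`, bilinear in `a` and `b`. -/
def wedge : T →ₗ[k] T →ₗ[k] T.Wedge := (TensorProduct.mk k T T).compr₂ T.diag.mkQ

variable {T} in
lemma wedge_self (a : T) : T.wedge a a = 0 :=
  (Submodule.Quotient.mk_eq_zero _).2 (Submodule.subset_span ⟨a, rfl⟩)

variable {T} in
lemma wedge_ext {M : Type w} [AddCommGroup M] [Module k M] {f g : T.Wedge →ₗ[k] M}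
    (h : ∀ a b, f (T.wedge a b) = g (T.wedge a b)) : f = g := by
  apply Submodule.linearMap_qext
  apply TensorProduct.ext'
  exact h

/-- `λ : T ∧ T → End T`, `a ∧ b ↦ D a b`. -/
def lam : T.Wedge →ₗ[k] Module.End k T :=
  T.diag.liftQ (TensorProduct.lift T.D) <| by
    rw [diag, Submodule.span_le]
    rintro _ ⟨a, rfl⟩
    ext b
    simpa [D] using T.str.bracket_self a b

@[simp] lemma lam_wedge (a b : T) : T.lam (T.wedge a b) = T.D a b := by
  simp [lam, wedge]

/-- An endomorphism `f` of `T` acts on `T ∧ T` by `a ∧ b ↦ f a ∧ b + a ∧ f b`. -/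
def wedgeAct : Module.End k T →ₗ[k] Module.End k T.Wedge where
  toFun f := T.diag.mapQ T.diag (f.rTensor T + f.lTensor T) <| by
    rw [diag, Submodule.span_le]
    rintro _ ⟨a, rfl⟩
    have h : f a ⊗ₜ[k] a + a ⊗ₜ[k] f a
        = (f a + a) ⊗ₜ[k] (f a + a) - f a ⊗ₜ[k] f a - a ⊗ₜ[k] a := by
      simp only [TensorProduct.add_tmul, TensorProduct.tmul_add]; abel
    change f a ⊗ₜ[k] a + a ⊗ₜ[k] f a ∈ T.diag
    rw [h]
    exact sub_mem (sub_mem (Submodule.subset_span ⟨_, rfl⟩) (Submodule.subset_span ⟨_, rfl⟩))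
      (Submodule.subset_span ⟨_, rfl⟩)
  map_add' f g := by
    apply wedge_ext
    intro a b
    change T.wedge (f a + g a) b + T.wedge a (f b + g b)
      = T.wedge (f a) b + T.wedge a (f b) + (T.wedge (g a) b + T.wedge a (g b))
    simp only [map_add, LinearMap.add_apply]
    abel
  map_smul' c f := by
    apply wedge_ext
    intro a b
    change T.wedge (c • f a) b + T.wedge a (c • f b) = c • (T.wedge (f a) b + T.wedge a (f b))
    simp only [map_smul, LinearMap.smul_apply, smul_add]

lemma wedgeAct_wedge (f : Module.End k T) (a b : T) :
    T.wedgeAct f (T.wedge a b) = T.wedge (f a) b + T.wedge a (f b) := rfl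

/-- The action of `λ(x)` on `T ∧ T`, that is
`(a ∧ b) · (c ∧ d) = D^{α⁻¹} a b c ∧ d + c ∧ D^{α⁻¹} a b d`. -/
def lamAct : T.Wedge →ₗ[k] Module.End k T.Wedge := T.wedgeAct ∘ₗ T.untwist ∘ₗ T.lam

/-- `A(T ∧ T)`, the span of all `λ(x) · x` with `x ∈ T ∧ T`. -/
def relA : Submodule k T.Wedge := Submodule.span k (Set.range fun x => T.lamAct x x)

/-- The quotient `⟨T, T⟩ = (T ∧ T) / A(T ∧ T)`. -/
abbrev Angle : Type v := T.Wedge ⧸ T.relA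

/-- The element `⟨a, b⟩`, bilinear in `a` and `b`. -/
def angle : T →ₗ[k] T →ₗ[k] T.Angle :=
  T.wedge.compr₂ T.relA.mkQ

variable {T}

lemma mkQ_wedge (a b : T) : T.relA.mkQ (T.wedge a b) = T.angle a b := rfl

lemma angle_self (a : T) : T.angle a a = 0 := by
  rw [← mkQ_wedge, wedge_self, map_zero]

lemma angle_ext {M : Type w} [AddCommGroup M] [Module k M] {f g : T.Angle →ₗ[k] M}
    (h : ∀ a b, f (T.angle a b) = g (T.angle a b)) : f = g := by
  apply Submodule.linearMap_qext
  apply wedge_ext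
  exact h

lemma twist_bracket (a b c : T) :
    T.twist (T.str.bracket a b c) = T.str.bracket (T.twist a) (T.twist b) (T.twist c) :=
  (T.regular.isHom.map_bracket a b c).symm

lemma untwist_D (a b c : T) : T.untwist (T.D a b) c = T.twist.symm (T.str.bracket a b c) := rfl

/-- The untwisted bracket `α⁻¹ [a, b, c]` satisfies the Leibniz rule of a Lie triple system. -/
lemma untwist_leibniz (a b c d e : T) :
    T.untwist (T.D a b) (T.untwist (T.D c d) e) =
      T.untwist (T.D (T.untwist (T.D a b) c) d) e
        + T.untwist (T.D c (T.untwist (T.D a b) d)) e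
        + T.untwist (T.D c d) (T.untwist (T.D a b) e) := by
  have h := T.str.hom_nambu a b c d e
  rw [← T.regular.twist_eq] at h
  apply T.twist.injective
  apply T.twist.injective
  simp only [map_add, untwist_D, LinearEquiv.apply_symm_apply]
  simp only [twist_bracket, LinearEquiv.apply_symm_apply]
  exact h

lemma untwist_lam_wedgeAct (a b : T) (x : T.Wedge) :
    T.untwist (T.lam (T.wedgeAct (T.untwist (T.D a b)) x)) =
      T.untwist (T.D a b) * T.untwist (T.lam x) - T.untwist (T.lam x) * T.untwist (T.D a b) := by
  have : T.untwist ∘ₗ T.lam ∘ₗ T.wedgeAct (T.untwist (T.D a b)) =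
      LinearMap.mulLeft k (T.untwist (T.D a b)) ∘ₗ T.untwist ∘ₗ T.lam -
      LinearMap.mulRight k (T.untwist (T.D a b)) ∘ₗ T.untwist ∘ₗ T.lam := by
    apply wedge_ext
    intro c d
    apply LinearMap.ext
    intro e
    simp only [LinearMap.comp_apply, wedgeAct_wedge, map_add, lam_wedge, LinearMap.sub_apply,
      LinearMap.mulLeft_apply, LinearMap.mulRight_apply, LinearMap.add_apply, Module.End.mul_apply]
    rw [untwist_leibniz a b c d e]
    abel
  exact LinearMap.congr_fun this x

/-- `λ` is equivariant: `λ(λ(x) · y) = [λ(x), λ(y)]`, in untwisted form. -/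
lemma untwist_lam_lamAct (x y : T.Wedge) :
    T.untwist (T.lam (T.lamAct x y)) =
      T.untwist (T.lam x) * T.untwist (T.lam y) - T.untwist (T.lam y) * T.untwist (T.lam x) := by
  have : (LinearMap.llcomp k _ _ _ (T.untwist ∘ₗ T.lam)) ∘ₗ T.lamAct =
      (LinearMap.mul k (Module.End k T) - (LinearMap.mul k (Module.End k T)).flip).compl₁₂
        (T.untwist ∘ₗ T.lam) (T.untwist ∘ₗ T.lam) := by
    apply wedge_ext
    intro a b
    apply LinearMap.ext
    intro y
    simpa [lamAct] using untwist_lam_wedgeAct a b y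
  exact LinearMap.congr_fun (LinearMap.congr_fun this x) y

lemma wedgeAct_commutator (f g : Module.End k T) (x : T.Wedge) :
    T.wedgeAct (f * g - g * f) x = T.wedgeAct f (T.wedgeAct g x) - T.wedgeAct g (T.wedgeAct f x) := by
  have : T.wedgeAct (f * g - g * f) =
      T.wedgeAct f ∘ₗ T.wedgeAct g - T.wedgeAct g ∘ₗ T.wedgeAct f := by
    apply wedge_ext
    intro a b
    simp only [wedgeAct_wedge, LinearMap.sub_apply, LinearMap.comp_apply, map_add,
      Module.End.mul_apply, map_sub]
    abel
  exact LinearMap.congr_fun this x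

lemma lamAct_lamAct (x y z : T.Wedge) :
    T.lamAct (T.lamAct x y) z = T.lamAct x (T.lamAct y z) - T.lamAct y (T.lamAct x z) := by
  change T.wedgeAct (T.untwist (T.lam (T.lamAct x y))) z = _
  rw [untwist_lam_lamAct, wedgeAct_commutator]
  rfl

lemma lamAct_self_mem (x : T.Wedge) : T.lamAct x x ∈ T.relA := Submodule.subset_span ⟨x, rfl⟩

lemma relA_le_comap (x : T.Wedge) : T.relA ≤ T.relA.comap (T.lamAct x) := by
  nth_rewrite 1 [relA]
  rw [Submodule.span_le]
  rintro _ ⟨y, rfl⟩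
  have h : T.lamAct x (T.lamAct y y) =
      T.lamAct (T.lamAct x y + y) (T.lamAct x y + y)
        - T.lamAct (T.lamAct x y) (T.lamAct x y) - T.lamAct y y := by
    have h1 := lamAct_lamAct x y y
    simp only [map_add, LinearMap.add_apply]
    rw [h1]
    abel
  change T.lamAct x (T.lamAct y y) ∈ T.relA
  rw [h]
  exact sub_mem (sub_mem (lamAct_self_mem _) (lamAct_self_mem _)) (lamAct_self_mem _)

lemma relA_le_ker : T.relA ≤ LinearMap.ker (T.untwist ∘ₗ T.lam) := by
  rw [relA, Submodule.span_le]
  rintro _ ⟨y, rfl⟩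
  change T.untwist (T.lam (T.lamAct y y)) = 0
  rw [untwist_lam_lamAct, sub_self]

lemma untwist_eq_zero {f : Module.End k T} (h : T.untwist f = 0) : f = 0 := by
  ext a
  have := LinearMap.congr_fun h a
  exact T.twist.symm.injective (by simpa [untwist] using this)

variable (T)

/-- `μ : ⟨T, T⟩ → End T`, `⟨a, b⟩ ↦ D a b`. -/
def mu : T.Angle →ₗ[k] Module.End k T :=
  T.relA.liftQ T.lam fun _ hx => untwist_eq_zero (relA_le_ker hx)

@[simp] lemma mu_angle (a b : T) : T.mu (T.angle a b) = T.D a b := lam_wedge T a b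

/-- The bracket `[⟨a, b⟩, ⟨c, d⟩] = ⟨D^{α⁻¹} a b c, d⟩ + ⟨c, D^{α⁻¹} a b d⟩` on `⟨T, T⟩`. -/
def angleBracket : T.Angle →ₗ[k] T.Angle →ₗ[k] T.Angle :=
  T.relA.liftQ
    { toFun := fun x => T.relA.mapQ T.relA (T.lamAct x) (relA_le_comap x)
      map_add' := fun x y => by apply Submodule.linearMap_qext; ext; simp
      map_smul' := fun c x => by apply Submodule.linearMap_qext; ext; simp } <| by
    intro x hx
    have h : T.lamAct x = 0 := by
      have := relA_le_ker hx
      change T.wedgeAct (T.untwist (T.lam x)) = 0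
      rw [show T.untwist (T.lam x) = 0 from this, map_zero]
    apply Submodule.linearMap_qext
    ext
    simp [h]

variable {T}

lemma angleBracket_mk (x y : T.Wedge) :
    T.angleBracket (T.relA.mkQ x) (T.relA.mkQ y) = T.relA.mkQ (T.lamAct x y) := rfl

lemma angleBracket_angle (a b c d : T) :
    T.angleBracket (T.angle a b) (T.angle c d) =
      T.angle (T.untwist (T.D a b) c) d + T.angle c (T.untwist (T.D a b) d) := by
  change T.relA.mkQ (T.lamAct (T.wedge a b) (T.wedge c d)) = _
  simp only [lamAct, LinearMap.comp_apply, lam_wedge, wedgeAct_wedge, map_add, mkQ_wedge]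

lemma angleBracket_right (X : T.Angle) (a b : T) :
    T.angleBracket X (T.angle a b) =
      T.angle (T.untwist (T.mu X) a) b + T.angle a (T.untwist (T.mu X) b) := by
  obtain ⟨x, rfl⟩ := T.relA.mkQ_surjective X
  change T.relA.mkQ (T.lamAct x (T.wedge a b)) = _
  simp only [lamAct, LinearMap.comp_apply, wedgeAct_wedge, map_add, mkQ_wedge]
  rfl

lemma angleBracket_self (X : T.Angle) : T.angleBracket X X = 0 := by
  obtain ⟨x, rfl⟩ := T.relA.mkQ_surjective X
  rw [angleBracket_mk]
  exact (Submodule.Quotient.mk_eq_zero _).2 (lamAct_self_mem x)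

lemma angleBracket_leibniz (X Y Z : T.Angle) :
    T.angleBracket X (T.angleBracket Y Z) =
      T.angleBracket (T.angleBracket X Y) Z + T.angleBracket Y (T.angleBracket X Z) := by
  obtain ⟨x, rfl⟩ := T.relA.mkQ_surjective X
  obtain ⟨y, rfl⟩ := T.relA.mkQ_surjective Y
  obtain ⟨z, rfl⟩ := T.relA.mkQ_surjective Z
  simp only [angleBracket_mk, lamAct_lamAct, map_sub]
  abel

lemma untwist_mu_angleBracket (X Y : T.Angle) (a : T) :
    T.untwist (T.mu (T.angleBracket X Y)) a =
      T.untwist (T.mu X) (T.untwist (T.mu Y) a) - T.untwist (T.mu Y) (T.untwist (T.mu X) a) := by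
  obtain ⟨x, rfl⟩ := T.relA.mkQ_surjective X
  obtain ⟨y, rfl⟩ := T.relA.mkQ_surjective Y
  exact LinearMap.congr_fun (untwist_lam_lamAct x y) a

lemma untwist_cyclic (a b c : T) :
    T.untwist (T.D a b) c + T.untwist (T.D b c) a + T.untwist (T.D c a) b = 0 := by
  simp only [untwist_D, ← map_add, T.str.bracket_cyclic, map_zero]

lemma untwist_skew (a b c : T) : T.untwist (T.D a b) c = - T.untwist (T.D b a) c := by
  have h := T.str.bracket_self (a + b) c
  simp only [map_add, LinearMap.add_apply, T.str.bracket_self, zero_add, add_zero] at h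
  rw [untwist_D, untwist_D, ← map_neg, eq_neg_of_add_eq_zero_right h]

lemma angle_skew (a b : T) : T.angle a b = - T.angle b a := by
  have h := angle_self (a + b)
  simp only [map_add, LinearMap.add_apply, angle_self, zero_add, add_zero] at h
  exact eq_neg_of_add_eq_zero_right h

/-! ### The Lie algebra `U(T)` -/

variable (T) in
/-- The underlying module `U(T) = ⟨T, T⟩ ⊕ T` of the universal imbedding of `T`; the pair
`(X, a)` stands for `X + a`. -/
@[ext]
structure U where
  even : T.Angle
  odd : T

namespace U

variable (T) in
/-- `U(T)` as a product of modules. -/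
def equivProd : U T ≃ T.Angle × T where
  toFun p := (p.even, p.odd)
  invFun p := ⟨p.1, p.2⟩

instance : AddCommGroup (U T) := (equivProd T).addCommGroup
instance : Module k (U T) := (equivProd T).module k

@[simp] lemma add_even (p q : U T) : (p + q).even = p.even + q.even := rfl
@[simp] lemma add_odd (p q : U T) : (p + q).odd = p.odd + q.odd := rfl
@[simp] lemma zero_even : (0 : U T).even = 0 := rfl
@[simp] lemma zero_odd : (0 : U T).odd = 0 := rfl
@[simp] lemma smul_even (c : k) (p : U T) : (c • p).even = c • p.even := rfl
@[simp] lemma smul_odd (c : k) (p : U T) : (c • p).odd = c • p.odd := rfl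

/-- `[X + a, Y + b] = ([X, Y] + ⟨a, b⟩) + (μ^{α⁻¹}(X) b - μ^{α⁻¹}(Y) a)`. -/
instance : Bracket (U T) (U T) where
  bracket p q :=
    ⟨T.angleBracket p.even q.even + T.angle p.odd q.odd,
      T.untwist (T.mu p.even) q.odd - T.untwist (T.mu q.even) p.odd⟩

@[simp] lemma lie_even (p q : U T) :
    ⁅p, q⁆.even = T.angleBracket p.even q.even + T.angle p.odd q.odd := rfl
@[simp] lemma lie_odd (p q : U T) :
    ⁅p, q⁆.odd = T.untwist (T.mu p.even) q.odd - T.untwist (T.mu q.even) p.odd := rfl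

instance : LieRing (U T) where
  add_lie p q r := by
    ext
    · simp only [lie_even, add_even, add_odd, map_add, LinearMap.add_apply]; abel
    · simp only [lie_odd, add_even, add_odd, map_add, LinearMap.add_apply]; abel
  lie_add p q r := by
    ext
    · simp only [lie_even, add_even, add_odd, map_add]; abel
    · simp only [lie_odd, add_even, add_odd, map_add, LinearMap.add_apply]; abel
  lie_self p := by
    ext
    · simp [angleBracket_self, angle_self]
    · simp
  leibniz_lie p q r := by
    ext
    · have skew : ∀ X Y : T.Angle, T.angleBracket X Y = - T.angleBracket Y X := by
        intro X Y
        have h := angleBracket_self (X + Y)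
        simp only [map_add, LinearMap.add_apply, angleBracket_self, zero_add, add_zero] at h
        exact eq_neg_of_add_eq_zero_right h
      simp only [lie_even, lie_odd, add_even, map_add, map_sub, LinearMap.add_apply,
        LinearMap.sub_apply, angleBracket_right]
      rw [angleBracket_leibniz p.even q.even r.even, skew (T.angle p.odd q.odd) r.even,
        angleBracket_right, angle_skew (T.untwist (T.mu r.even) p.odd) q.odd]
      abel
    · simp only [lie_even, lie_odd, add_odd, map_add, map_sub, LinearMap.add_apply,
        untwist_mu_angleBracket, mu_angle]
      have h := untwist_cyclic p.odd q.odd r.odd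
      rw [untwist_skew r.odd p.odd] at h
      have h' : T.untwist (T.D q.odd r.odd) p.odd =
          T.untwist (T.D p.odd r.odd) q.odd - T.untwist (T.D p.odd q.odd) r.odd := by
        rw [← sub_eq_zero, ← h]; abel
      rw [h']
      abel

instance : LieAlgebra k (U T) where
  lie_smul c p q := by
    ext
    · simp [smul_add]
    · simp [smul_sub]

variable (T) in
/-- The `ℤ₂`-grading of `U(T)`, with even component `⟨T, T⟩` and odd component `T`. -/
def grading (i : ZMod 2) : Submodule k (U T) where
  carrier := {p | (i = 0 → p.odd = 0) ∧ (i = 1 → p.even = 0)}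
  zero_mem' := by simp
  add_mem' {p q} hp hq := ⟨fun h => by simp [hp.1 h, hq.1 h], fun h => by simp [hp.2 h, hq.2 h]⟩
  smul_mem' c p hp := ⟨fun h => by simp [hp.1 h], fun h => by simp [hp.2 h]⟩

lemma mem_grading_zero {p : U T} : p ∈ grading T 0 ↔ p.odd = 0 :=
  ⟨fun h => h.1 rfl, fun h => ⟨fun _ => h, fun h' => absurd h' (by decide)⟩⟩

lemma mem_grading_one {p : U T} : p ∈ grading T 1 ↔ p.even = 0 :=
  ⟨fun h => h.2 rfl, fun h => ⟨fun h' => absurd h' (by decide), fun _ => h⟩⟩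

variable (T) in
/-- The projection `X + a ↦ X` onto the even component. -/
def evenPart : U T →ₗ[k] grading T 0 where
  toFun p := ⟨⟨p.even, 0⟩, mem_grading_zero.2 rfl⟩
  map_add' p q := by apply Subtype.ext; ext <;> simp
  map_smul' c p := by apply Subtype.ext; ext <;> simp

variable (T) in
/-- The projection `X + a ↦ a` onto the odd component. -/
def oddPart : U T →ₗ[k] grading T 1 where
  toFun p := ⟨⟨0, p.odd⟩, mem_grading_one.2 rfl⟩
  map_add' p q := by apply Subtype.ext; ext <;> simp
  map_smul' c p := by apply Subtype.ext; ext <;> simp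

instance : GradedLieAlgebra (grading T) where
  bracket_mem := by
    have key : ∀ i : ZMod 2, i = 0 ∨ i = 1 := by decide
    intro i j p q hp hq
    rcases key i with rfl | rfl <;> rcases key j with rfl | rfl
    · rw [add_zero, mem_grading_zero] at *; simp [hp, hq]
    · rw [zero_add, mem_grading_one] at *; rw [mem_grading_zero] at hp; simp [hp, hq]
    · rw [add_zero, mem_grading_one] at *; rw [mem_grading_zero] at hq; simp [hp, hq]
    · rw [show (1 + 1 : ZMod 2) = 0 from by decide, mem_grading_zero]
      rw [mem_grading_one] at hp hq; simp [hp, hq]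
  toDecomposition := DirectSum.Decomposition.ofLinearMap (grading T)
    (DirectSum.lof k (ZMod 2) (fun i => grading T i) 0 ∘ₗ evenPart T +
      DirectSum.lof k (ZMod 2) (fun i => grading T i) 1 ∘ₗ oddPart T)
    (by
      apply LinearMap.ext
      intro p
      ext <;> simp [evenPart, oddPart])
    (by
      have key : ∀ i : ZMod 2, i = 0 ∨ i = 1 := by decide
      apply DirectSum.linearMap_ext
      intro i
      apply LinearMap.ext
      rintro ⟨p, hp⟩
      rcases key i with rfl | rfl
      · have h0 : evenPart T p = ⟨p, hp⟩ := by
          apply Subtype.ext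
          ext
          · rfl
          · exact (mem_grading_zero.1 hp).symm
        have h1 : oddPart T p = 0 := by
          apply Subtype.ext
          ext
          · rfl
          · exact (mem_grading_zero (p := p)).1 hp
        simp [h0, h1]
      · have h0 : evenPart T p = 0 := by
          apply Subtype.ext
          ext
          · exact (mem_grading_one (p := p)).1 hp
          · rfl
        have h1 : oddPart T p = ⟨p, hp⟩ := by
          apply Subtype.ext
          ext
          · exact (mem_grading_one.1 hp).symm
          · rfl
        simp [h0, h1])

/-! ### Functoriality of `U(T)` -/

end U

variable {S R : RLTS.{u, v} k}

lemma Hom.map_twist (f : T ⟶ S) (a : T) :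
    f.toLinearMap (T.twist a) = S.twist (f.toLinearMap a) := f.isHom.comm₁ a

lemma Hom.map_untwist (f : T ⟶ S) (a b c : T) :
    f.toLinearMap (T.untwist (T.D a b) c) =
      S.untwist (S.D (f.toLinearMap a) (f.toLinearMap b)) (f.toLinearMap c) := by
  apply S.twist.injective
  rw [← Hom.map_twist, untwist_D, untwist_D, LinearEquiv.apply_symm_apply,
    LinearEquiv.apply_symm_apply, f.isHom.map_bracket]

/-- The map `T ∧ T → S ∧ S`, `a ∧ b ↦ f a ∧ f b`. -/
def wedgeMap (f : T ⟶ S) : T.Wedge →ₗ[k] S.Wedge :=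
  T.diag.mapQ S.diag (TensorProduct.map f.toLinearMap f.toLinearMap) <| by
    rw [diag, Submodule.span_le]
    rintro _ ⟨a, rfl⟩
    exact Submodule.subset_span ⟨f.toLinearMap a, rfl⟩

lemma wedgeMap_wedge (f : T ⟶ S) (a b : T) :
    wedgeMap f (T.wedge a b) = S.wedge (f.toLinearMap a) (f.toLinearMap b) := rfl

lemma wedgeMap_lamAct (f : T ⟶ S) (x y : T.Wedge) :
    wedgeMap f (T.lamAct x y) = S.lamAct (wedgeMap f x) (wedgeMap f y) := by
  have : T.lamAct.compr₂ (wedgeMap f) = S.lamAct.compl₁₂ (wedgeMap f) (wedgeMap f) := by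
    apply wedge_ext
    intro a b
    apply wedge_ext
    intro c d
    simp only [LinearMap.compr₂_apply, LinearMap.compl₁₂_apply, wedgeMap_wedge, lamAct,
      LinearMap.comp_apply, lam_wedge, wedgeAct_wedge, map_add, Hom.map_untwist]
  exact LinearMap.congr_fun (LinearMap.congr_fun this x) y

/-- The map `⟨T, T⟩ → ⟨S, S⟩`, `⟨a, b⟩ ↦ ⟨f a, f b⟩`. -/
def angleMap (f : T ⟶ S) : T.Angle →ₗ[k] S.Angle :=
  T.relA.mapQ S.relA (wedgeMap f) <| by
    rw [relA, Submodule.span_le]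
    rintro _ ⟨x, rfl⟩
    change wedgeMap f (T.lamAct x x) ∈ S.relA
    rw [wedgeMap_lamAct]
    exact lamAct_self_mem _

@[simp] lemma angleMap_angle (f : T ⟶ S) (a b : T) :
    angleMap f (T.angle a b) = S.angle (f.toLinearMap a) (f.toLinearMap b) := rfl

lemma angleMap_angleBracket (f : T ⟶ S) (X Y : T.Angle) :
    angleMap f (T.angleBracket X Y) = S.angleBracket (angleMap f X) (angleMap f Y) := by
  obtain ⟨x, rfl⟩ := T.relA.mkQ_surjective X
  obtain ⟨y, rfl⟩ := T.relA.mkQ_surjective Y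
  rw [angleBracket_mk]
  exact congrArg S.relA.mkQ (wedgeMap_lamAct f x y)

lemma map_untwist_mu (f : T ⟶ S) (X : T.Angle) (a : T) :
    f.toLinearMap (T.untwist (T.mu X) a) =
      S.untwist (S.mu (angleMap f X)) (f.toLinearMap a) := by
  have : (LinearMap.llcomp k T T S f.toLinearMap) ∘ₗ T.untwist ∘ₗ T.mu =
      (LinearMap.lcomp k S f.toLinearMap) ∘ₗ S.untwist ∘ₗ S.mu ∘ₗ angleMap f := by
    apply angle_ext
    intro b c
    apply LinearMap.ext
    intro d
    simpa using Hom.map_untwist f b c d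
  exact LinearMap.congr_fun (LinearMap.congr_fun this X) a

namespace U

/-- The Lie algebra homomorphism `U(T) → U(S)` induced by a Hom-LTS homomorphism `f : T → S`,
determined by `a ↦ f a` and `⟨a, b⟩ ↦ ⟨f a, f b⟩ = [f a, f b]`. -/
def map (f : T ⟶ S) : U T →ₗ⁅k⁆ U S where
  toFun p := ⟨angleMap f p.even, f.toLinearMap p.odd⟩
  map_add' p q := by ext <;> simp
  map_smul' c p := by ext <;> simp
  map_lie' {p q} := by
    ext
    · simp [angleMap_angleBracket]
    · simp [map_untwist_mu]

@[simp] lemma map_even (f : T ⟶ S) (p : U T) : (map f p).even = angleMap f p.even := rfl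
@[simp] lemma map_odd (f : T ⟶ S) (p : U T) : (map f p).odd = f.toLinearMap p.odd := rfl

lemma map_id (p : U T) : map (𝟙 T) p = p := by
  have : angleMap (𝟙 T) = LinearMap.id := angle_ext fun _ _ => rfl
  ext
  · simp [this]
  · rfl

lemma map_comp (f : T ⟶ S) (g : S ⟶ R) (p : U T) : map (f ≫ g) p = map g (map f p) := by
  have : angleMap (f ≫ g) = angleMap g ∘ₗ angleMap f := angle_ext fun _ _ => rfl
  ext
  · simp [this]
  · rfl

lemma map_mem (f : T ⟶ S) (i : ZMod 2) (p : U T) (hp : p ∈ grading T i) :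
    map f p ∈ grading S i :=
  ⟨fun h => by simp [hp.1 h], fun h => by simp [hp.2 h]⟩

end U

variable (T) in
/-- The twisting map as an endomorphism of `T` in the category of regular Hom-LTS. -/
def twistHom : T ⟶ T := ⟨T.str.twist₁, T.regular.isHom⟩

variable (T) in
/-- The inverse of the twisting map, as an endomorphism of `T`. -/
def twistInv : T ⟶ T :=
  ⟨T.twist.symm.toLinearMap, by
    have h1 : ∀ a, T.twist.symm (T.str.twist₁ a) = T.str.twist₁ (T.twist.symm a) := fun a =>
      (T.twist.symm_apply_apply a).trans (T.twist.apply_symm_apply a).symm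
    refine ⟨fun a b c => ?_, h1, ?_⟩
    · apply T.twist.injective
      simp [twist_bracket]
    · rw [← T.regular.twist_eq]; exact h1⟩

lemma twistHom_twistInv : T.twistHom ≫ T.twistInv = 𝟙 T :=
  Hom.ext (LinearMap.ext fun a => T.twist.symm_apply_apply a)

lemma twistInv_twistHom : T.twistInv ≫ T.twistHom = 𝟙 T :=
  Hom.ext (LinearMap.ext fun a => T.twist.apply_symm_apply a)

lemma twistHom_naturality (f : T ⟶ S) : T.twistHom ≫ f = f ≫ S.twistHom :=
  Hom.ext (LinearMap.ext fun a => f.isHom.comm₁ a)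

variable (T) in
/-- The automorphism `α_U` of `U(T)`, given by `a ↦ α a` and `⟨a, b⟩ ↦ ⟨α a, α b⟩`. -/
def U.twist : U T ≃ₗ⁅k⁆ U T :=
  { U.map T.twistHom with
    invFun := U.map T.twistInv
    left_inv := fun p => by
      change U.map T.twistInv (U.map T.twistHom p) = p
      rw [← U.map_comp, twistHom_twistInv, U.map_id]
    right_inv := fun p => by
      change U.map T.twistHom (U.map T.twistInv p) = p
      rw [← U.map_comp, twistInv_twistHom, U.map_id] }

end RLTS

/-! ### The category of `ℤ₂`-graded Lie algebras with a graded automorphism -/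

/-- A pair `(L, α)` of a `ℤ₂`-graded Lie algebra `L` over `k` and a graded automorphism `α`. -/
structure TLZ2 (k : Type u) [CommRing k] where
  carrier : Type v
  [lieRing : LieRing carrier]
  [lieAlgebra : LieAlgebra k carrier]
  grading : ZMod 2 → Submodule k carrier
  [graded : GradedLieAlgebra grading]
  twist : carrier ≃ₗ⁅k⁆ carrier
  twist_mem : ∀ i, ∀ x ∈ grading i, twist x ∈ grading i

namespace TLZ2

variable {k : Type u} [CommRing k]

instance : CoeSort (TLZ2.{u, v} k) (Type v) := ⟨TLZ2.carrier⟩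

instance (L : TLZ2.{u, v} k) : LieRing L := L.lieRing
instance (L : TLZ2.{u, v} k) : LieAlgebra k L := L.lieAlgebra
instance (L : TLZ2.{u, v} k) : GradedLieAlgebra L.grading := L.graded

/-- Morphisms are the graded Lie algebra homomorphisms commuting with the automorphisms. -/
@[ext]
structure Hom (L M : TLZ2.{u, v} k) where
  toLieHom : L →ₗ⁅k⁆ M
  map_mem : ∀ i, ∀ x ∈ L.grading i, toLieHom x ∈ M.grading i
  comm : ∀ x, toLieHom (L.twist x) = M.twist (toLieHom x)

instance : Category (TLZ2.{u, v} k) where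
  Hom L M := Hom L M
  id L := ⟨LieHom.id, fun _ _ h => h, fun _ => rfl⟩
  comp f g := ⟨g.toLieHom.comp f.toLieHom, fun i x h => g.map_mem i _ (f.map_mem i x h),
    fun x => by simp [f.comm, g.comm]⟩

end TLZ2

/-- A `ℤ₂`-graded Lie algebra `L` is centrally 0-closed if every central 0-extension of `L` splits:
for every surjective graded homomorphism `π : K → L` of `ℤ₂`-graded Lie algebras whose kernel is
central in `K` and contained in `K₀`, there is a graded homomorphism `s : L → K` with `π ∘ s = id`. -/
def IsCentrallyZeroClosed {k : Type u} [CommRing k] {L : Type v} [LieRing L] [LieAlgebra k L]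
    (𝓛 : ZMod 2 → Submodule k L) : Prop :=
  ∀ (K : Type v) [LieRing K] [LieAlgebra k K] (𝓚 : ZMod 2 → Submodule k K) [GradedLieAlgebra 𝓚]
    (π : K →ₗ⁅k⁆ L),
    (∀ i, ∀ x ∈ 𝓚 i, π x ∈ 𝓛 i) →
    Function.Surjective π →
    π.ker ≤ LieAlgebra.center k K →
    (∀ x, π x = 0 → x ∈ 𝓚 0) →
    ∃ s : L →ₗ⁅k⁆ K, (∀ i, ∀ x ∈ 𝓛 i, s x ∈ 𝓚 i) ∧ ∀ x, π (s x) = x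

/-- The `ℤ₂`-graded Lie algebra `L` is generated, as a Lie algebra, by its odd component `L₁`. -/
def IsGeneratedByOdd {k : Type u} [CommRing k] {L : Type v} [LieRing L] [LieAlgebra k L]
    (𝓛 : ZMod 2 → Submodule k L) : Prop :=
  LieSubalgebra.lieSpan k L (𝓛 1 : Set L) = ⊤

/-- The property of pairs `(L, α)` that `L` is centrally 0-closed and generated by its odd
component. -/
def TLZ2.closedOddGenerated (k : Type u) [CommRing k] : ObjectProperty (TLZ2.{u, v} k) :=
  fun L => IsCentrallyZeroClosed L.grading ∧ IsGeneratedByOdd L.grading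

/-- The functor `𝔄`, sending `T` to `(U(T), α_U)`. -/
def functorA (k : Type u) [CommRing k] : RLTS.{u, v} k ⥤ TLZ2.{u, v} k where
  obj T :=
    { carrier := RLTS.U T
      grading := RLTS.U.grading T
      twist := RLTS.U.twist T
      twist_mem := RLTS.U.map_mem T.twistHom }
  map {T S} f :=
    { toLieHom := RLTS.U.map f
      map_mem := RLTS.U.map_mem f
      comm := fun p => by
        change RLTS.U.map f (RLTS.U.map T.twistHom p) = RLTS.U.map S.twistHom (RLTS.U.map f p)
        rw [← RLTS.U.map_comp, ← RLTS.U.map_comp, RLTS.twistHom_naturality] }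
  map_id T := TLZ2.Hom.ext (LieHom.ext fun p => RLTS.U.map_id p)
  map_comp f g := TLZ2.Hom.ext (LieHom.ext fun p => RLTS.U.map_comp f g p)

end

/-!
The argument rests on one universal property of `U(T)`: a linear map `σ` from `T` to a Lie algebra
`K` satisfying `⁅⁅σ a, σ b⁆, σ c⁆ = σ (α⁻¹ [a, b, c])` extends uniquely to a Lie algebra
homomorphism `U(T) → K` (`RLTS.U.lift`, `RLTS.U.lieHom_ext`). On `T ∧ T` it is
`a ∧ b ↦ ⁅σ a, σ b⁆`, and the condition on `σ` makes this map carry `λ(x) · y` to the bracket of the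
images of `x` and `y`; hence `λ(x) · x` goes to zero and the map descends to `⟨T, T⟩`.

Uniqueness, that is, generation of `U(T)` by its odd part, gives fullness: a morphism
`U(T) → U(S)` restricts to a Hom-LTS homomorphism on odd parts and is determined by it.

If `π : K → U(T)` is a central 0-extension, its kernel is even, so `π` is bijective on odd parts.
The inverse `σ : T → K₁` satisfies the condition above because `⁅⁅σ a, σ b⁆, σ c⁆` is odd and
can be compared after applying `π`; its extension to `U(T)` is the splitting.

For essential surjectivity, the odd part `T = L₁` of `(L, α)` is a regular Hom-LTS under
`[a, b, c] = α ⁅⁅a, b⁆, c⁆`. The inclusion `L₁ → L` extends to `θ : U(L₁) → L`, which is onto if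
`L₁` generates `L`. An element of its kernel is even and kills `L₁`, hence is central, so `θ` is a
central 0-extension of `L`. When `L` is centrally 0-closed it has a graded section `s`; as `s ∘ θ`
fixes the odd part, it is the identity, and `θ` is an isomorphism.
-/

noncomputable section

/-! ### Even and odd parts of a `ℤ₂`-graded Lie algebra -/

namespace GradedLieAlgebra

variable {k : Type u} [CommRing k] {L : Type v} [LieRing L] [LieAlgebra k L]
  (𝓛 : ZMod 2 → Submodule k L) [GradedLieAlgebra 𝓛]

lemma exists_even_add_odd (x : L) : ∃ a ∈ 𝓛 0, ∃ b ∈ 𝓛 1, a + b = x := by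
  induction x using DirectSum.Decomposition.inductionOn 𝓛 with
  | zero => exact ⟨0, zero_mem _, 0, zero_mem _, add_zero 0⟩
  | @homogeneous i m =>
    have key : ∀ i : ZMod 2, i = 0 ∨ i = 1 := by decide
    rcases key i with rfl | rfl
    · exact ⟨m, m.2, 0, zero_mem _, add_zero _⟩
    · exact ⟨0, zero_mem _, m, m.2, zero_add _⟩
  | add x y hx hy =>
    obtain ⟨a, ha, b, hb, rfl⟩ := hx
    obtain ⟨c, hc, d, hd, rfl⟩ := hy
    exact ⟨a + c, add_mem ha hc, b + d, add_mem hb hd, add_add_add_comm _ _ _ _⟩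

variable {𝓛}

lemma eq_zero_of_mem_even_of_mem_odd {x : L} (h0 : x ∈ 𝓛 0) (h1 : x ∈ 𝓛 1) : x = 0 := by
  by_contra hx
  exact absurd (DirectSum.degree_eq_of_mem_mem 𝓛 h0 h1 hx) (by decide)

lemma lie_odd_odd_mem {x y : L} (hx : x ∈ 𝓛 1) (hy : y ∈ 𝓛 1) : ⁅x, y⁆ ∈ 𝓛 0 :=
  SetLike.GradedBracket.bracket_mem (ℒ := 𝓛) (i := 1) (j := 1) hx hy

lemma lie_lie_odd_mem {x y z : L} (hx : x ∈ 𝓛 1) (hy : y ∈ 𝓛 1) (hz : z ∈ 𝓛 1) :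
    ⁅⁅x, y⁆, z⁆ ∈ 𝓛 1 :=
  SetLike.GradedBracket.bracket_mem (ℒ := 𝓛) (i := 0) (j := 1) (lie_odd_odd_mem hx hy) hz

end GradedLieAlgebra

open GradedLieAlgebra

namespace RLTS.U

variable {k : Type u} [CommRing k] {T S : RLTS.{u, v} k}

/-! ### Generation of `U(T)` by its odd part -/

variable (T) in
/-- The inclusion of `⟨T, T⟩` into `U(T)` as the even part. -/
def ofEven : T.Angle →ₗ[k] U T where
  toFun X := ⟨X, 0⟩
  map_add' _ _ := by ext <;> simp
  map_smul' _ _ := by ext <;> simp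

variable (T) in
/-- The inclusion of `T` into `U(T)` as the odd part. -/
def ofOdd : T →ₗ[k] U T where
  toFun a := ⟨0, a⟩
  map_add' _ _ := by ext <;> simp
  map_smul' _ _ := by ext <;> simp

@[simp] lemma ofEven_even (X : T.Angle) : (ofEven T X).even = X := rfl
@[simp] lemma ofEven_odd (X : T.Angle) : (ofEven T X).odd = 0 := rfl
@[simp] lemma ofOdd_even (a : T) : (ofOdd T a).even = 0 := rfl
@[simp] lemma ofOdd_odd (a : T) : (ofOdd T a).odd = a := rfl

lemma ofEven_add_ofOdd (p : U T) : ofEven T p.even + ofOdd T p.odd = p := by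
  ext <;> simp

lemma ofOdd_mem (a : T) : ofOdd T a ∈ grading T 1 := mem_grading_one.2 rfl

lemma eq_ofOdd_of_mem {p : U T} (hp : p ∈ grading T 1) : p = ofOdd T p.odd := by
  ext
  · exact mem_grading_one.1 hp
  · rfl

lemma lie_ofOdd_ofOdd (a b : T) : ⁅ofOdd T a, ofOdd T b⁆ = ofEven T (T.angle a b) := by
  ext <;> simp

lemma lie_lie_ofOdd (a b c : T) :
    ⁅⁅ofOdd T a, ofOdd T b⁆, ofOdd T c⁆ = ofOdd T (T.untwist (T.D a b) c) := by
  rw [lie_ofOdd_ofOdd]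
  ext <;> simp

/-- The elements `⟨a, b⟩` span `⟨T, T⟩`, phrased for the image under a linear map. -/
lemma map_angle_mem {M : Type v} [AddCommGroup M] [Module k M] (f : T.Angle →ₗ[k] M)
    (N : Submodule k M) (h : ∀ a b, f (T.angle a b) ∈ N) (X : T.Angle) : f X ∈ N := by
  have : N.mkQ ∘ₗ f = 0 := angle_ext fun a b => by simpa using h a b
  simpa using LinearMap.congr_fun this X

lemma isGeneratedByOdd : IsGeneratedByOdd (grading T) := by
  rw [IsGeneratedByOdd, eq_top_iff]
  intro p _
  have hodd : ∀ a, ofOdd T a ∈ LieSubalgebra.lieSpan k (U T) (grading T 1 : Set (U T)) :=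
    fun a => LieSubalgebra.subset_lieSpan (ofOdd_mem a)
  rw [← ofEven_add_ofOdd p]
  refine add_mem ?_ (hodd _)
  refine map_angle_mem (ofEven T) (LieSubalgebra.toSubmodule _) (fun a b => ?_) p.even
  rw [← lie_ofOdd_ofOdd]
  exact LieSubalgebra.lie_mem _ (hodd a) (hodd b)

lemma lieHom_ext {K : Type w} [LieRing K] [LieAlgebra k K] {f g : U T →ₗ⁅k⁆ K}
    (h : ∀ a, f (ofOdd T a) = g (ofOdd T a)) : f = g := by
  have he : f.toLinearMap ∘ₗ ofEven T = g.toLinearMap ∘ₗ ofEven T := by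
    apply angle_ext
    intro a b
    simp [← lie_ofOdd_ofOdd, h]
  ext p
  rw [← ofEven_add_ofOdd p, map_add, map_add, h]
  exact congrArg (· + _) (LinearMap.congr_fun he p.even)

/-! ### The universal property of `U(T)` -/

section Lift

variable {K : Type v} [LieRing K] [LieAlgebra k K]

variable (k K) in
/-- The bracket of a Lie algebra as a bilinear map. -/
def lieBilin : K →ₗ[k] K →ₗ[k] K :=
  LinearMap.mk₂ k (fun x y => ⁅x, y⁆) add_lie smul_lie lie_add lie_smul

@[simp] lemma lieBilin_apply (x y : K) : lieBilin k K x y = ⁅x, y⁆ := rfl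

/-- The map `T ∧ T → K`, `a ∧ b ↦ ⁅σ a, σ b⁆`. -/
def wedgeLift (σ : T →ₗ[k] K) : T.Wedge →ₗ[k] K :=
  T.diag.liftQ (TensorProduct.lift ((lieBilin k K).compl₁₂ σ σ)) <| by
    rw [diag, Submodule.span_le]
    rintro _ ⟨a, rfl⟩
    simp

lemma wedgeLift_wedge (σ : T →ₗ[k] K) (a b : T) :
    wedgeLift σ (T.wedge a b) = ⁅σ a, σ b⁆ := by
  simp [wedgeLift, wedge]

lemma lie_wedgeLift {σ : T →ₗ[k] K}
    (hσ : ∀ a b c, ⁅⁅σ a, σ b⁆, σ c⁆ = σ (T.untwist (T.D a b) c)) (x : T.Wedge) (c : T) :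
    ⁅wedgeLift σ x, σ c⁆ = σ (T.untwist (T.lam x) c) := by
  have : (lieBilin k K).compl₁₂ (wedgeLift σ) σ =
      (LinearMap.llcomp k T T K σ) ∘ₗ T.untwist ∘ₗ T.lam := by
    apply wedge_ext
    intro a b
    apply LinearMap.ext
    intro c
    simpa only [LinearMap.compl₁₂_apply, lieBilin_apply, wedgeLift_wedge, LinearMap.comp_apply,
      LinearMap.llcomp_apply, lam_wedge] using hσ a b c
  exact LinearMap.congr_fun (LinearMap.congr_fun this x) c

lemma wedgeLift_lamAct {σ : T →ₗ[k] K}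
    (hσ : ∀ a b c, ⁅⁅σ a, σ b⁆, σ c⁆ = σ (T.untwist (T.D a b) c)) (x y : T.Wedge) :
    wedgeLift σ (T.lamAct x y) = ⁅wedgeLift σ x, wedgeLift σ y⁆ := by
  have : wedgeLift σ ∘ₗ T.lamAct x = lieBilin k K (wedgeLift σ x) ∘ₗ wedgeLift σ := by
    apply wedge_ext
    intro c d
    simp only [LinearMap.comp_apply, lamAct, wedgeAct_wedge, map_add, wedgeLift_wedge,
      lieBilin_apply]
    rw [leibniz_lie, lie_wedgeLift hσ, lie_wedgeLift hσ]
  exact LinearMap.congr_fun this y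

variable (σ : T →ₗ[k] K) (hσ : ∀ a b c, ⁅⁅σ a, σ b⁆, σ c⁆ = σ (T.untwist (T.D a b) c))

/-- The map `⟨T, T⟩ → K`, `⟨a, b⟩ ↦ ⁅σ a, σ b⁆`. -/
def angleLift : T.Angle →ₗ[k] K :=
  T.relA.liftQ (wedgeLift σ) <| by
    rw [relA, Submodule.span_le]
    rintro _ ⟨x, rfl⟩
    exact (wedgeLift_lamAct hσ x x).trans (lie_self _)

lemma angleLift_angle (a b : T) : angleLift σ hσ (T.angle a b) = ⁅σ a, σ b⁆ :=
  wedgeLift_wedge σ a b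

lemma lie_angleLift (X : T.Angle) (c : T) :
    ⁅angleLift σ hσ X, σ c⁆ = σ (T.untwist (T.mu X) c) := by
  obtain ⟨x, rfl⟩ := T.relA.mkQ_surjective X
  exact lie_wedgeLift hσ x c

lemma angleLift_angleBracket (X Y : T.Angle) :
    angleLift σ hσ (T.angleBracket X Y) = ⁅angleLift σ hσ X, angleLift σ hσ Y⁆ := by
  obtain ⟨x, rfl⟩ := T.relA.mkQ_surjective X
  obtain ⟨y, rfl⟩ := T.relA.mkQ_surjective Y
  exact wedgeLift_lamAct hσ x y

/-- The Lie algebra homomorphism `U(T) → K` extending a linear map `σ : T → K` that turns the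
untwisted triple bracket of `T` into the iterated bracket of `K`. -/
def lift : U T →ₗ⁅k⁆ K where
  toFun p := angleLift σ hσ p.even + σ p.odd
  map_add' p q := by simp only [add_even, add_odd, map_add]; abel
  map_smul' c p := by simp
  map_lie' {p q} := by
    simp only [lie_even, lie_odd, map_add, map_sub, angleLift_angleBracket, angleLift_angle,
      add_lie, lie_add]
    rw [lie_angleLift, ← lie_skew (σ p.odd) (angleLift σ hσ q.even), lie_angleLift]
    abel

lemma lift_apply (p : U T) : lift σ hσ p = angleLift σ hσ p.even + σ p.odd := rfl

@[simp] lemma lift_ofOdd (a : T) : lift σ hσ (ofOdd T a) = σ a := by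
  simp [lift_apply]

variable {𝓚 : ZMod 2 → Submodule k K} [GradedLieAlgebra 𝓚]

lemma angleLift_mem (h : ∀ a, σ a ∈ 𝓚 1) (X : T.Angle) : angleLift σ hσ X ∈ 𝓚 0 :=
  map_angle_mem _ _ (fun a b => by
    rw [angleLift_angle]
    exact lie_odd_odd_mem (h a) (h b)) X

lemma lift_mem (h : ∀ a, σ a ∈ 𝓚 1) (i : ZMod 2) (p : U T) (hp : p ∈ grading T i) :
    lift σ hσ p ∈ 𝓚 i := by
  have key : ∀ i : ZMod 2, i = 0 ∨ i = 1 := by decide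
  rw [lift_apply]
  rcases key i with rfl | rfl
  · rw [mem_grading_zero.1 hp, map_zero, add_zero]
    exact angleLift_mem σ hσ h _
  · rw [mem_grading_one.1 hp, map_zero, zero_add]
    exact h _

end Lift

/-! ### `U(T)` is centrally 0-closed -/

lemma isCentrallyZeroClosed : IsCentrallyZeroClosed (grading T) := by
  intro K _ _ 𝓚 _ π hπ hsurj _ hker
  -- `oddMap` is the restriction of `π` to the odd parts.
  let oddMap : 𝓚 1 →ₗ[k] T :=
    { toFun := fun x => (π x).odd
      map_add' := fun x y => by simp
      map_smul' := fun c x => by simp }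
  have hodd : ∀ x : 𝓚 1, π x = ofOdd T (oddMap x) := fun x => eq_ofOdd_of_mem (hπ 1 x x.2)
  have hinj : ∀ x : K, x ∈ 𝓚 1 → π x = 0 → x = 0 := fun x hx h =>
    eq_zero_of_mem_even_of_mem_odd (hker x h) hx
  have hbij : Function.Bijective oddMap := by
    constructor
    · rw [injective_iff_map_eq_zero]
      intro x hx
      exact Subtype.ext (hinj x x.2 (by rw [hodd, hx, map_zero]))
    · intro a
      obtain ⟨x, hx⟩ := hsurj (ofOdd T a)
      obtain ⟨y, hy, z, hz, rfl⟩ := exists_even_add_odd 𝓚 x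
      refine ⟨⟨z, hz⟩, ?_⟩
      have h := congrArg U.odd hx
      rwa [map_add, add_odd, mem_grading_zero.1 (hπ 0 y hy), zero_add] at h
  let e := LinearEquiv.ofBijective oddMap hbij
  let σ : T →ₗ[k] K := (𝓚 1).subtype ∘ₗ e.symm.toLinearMap
  have hσ1 : ∀ a, σ a ∈ 𝓚 1 := fun a => (e.symm a).2
  have hπσ : ∀ a, π (σ a) = ofOdd T a := fun a =>
    (hodd (e.symm a)).trans (congrArg _ (e.apply_symm_apply a))
  have hσ : ∀ a b c, ⁅⁅σ a, σ b⁆, σ c⁆ = σ (T.untwist (T.D a b) c) := by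
    intro a b c
    refine sub_eq_zero.1 (hinj _ (sub_mem (lie_lie_odd_mem (hσ1 a) (hσ1 b) (hσ1 c)) (hσ1 _)) ?_)
    rw [map_sub, LieHom.map_lie, LieHom.map_lie, hπσ, hπσ, hπσ, hπσ, lie_lie_ofOdd, sub_self]
  refine ⟨lift σ hσ, lift_mem σ hσ hσ1, fun p => ?_⟩
  have : π.comp (lift σ hσ) = LieHom.id := lieHom_ext fun a => by simp [hπσ]
  exact LieHom.congr_fun this p

/-! ### The twisting maps and the functor on morphisms -/

lemma twist_ofOdd (a : T) : twist T (ofOdd T a) = ofOdd T (T.twist a) := by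
  change U.map T.twistHom (ofOdd T a) = _
  ext
  · simp
  · rfl

lemma map_ofOdd (f : T ⟶ S) (a : T) : map f (ofOdd T a) = ofOdd S (f.toLinearMap a) := by
  ext <;> simp

end RLTS.U

open RLTS RLTS.U

lemma functorA_faithful (k : Type u) [CommRing k] : (functorA.{u, v} k).Faithful where
  map_injective {T S} f g h := by
    apply RLTS.Hom.ext
    ext a
    have h' : U.map f = U.map g := congrArg TLZ2.Hom.toLieHom h
    exact congrArg U.odd (LieHom.congr_fun h' (ofOdd T a))

lemma functorA_full (k : Type u) [CommRing k] : (functorA.{u, v} k).Full where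
  map_surjective {T S} φ := by
    let F : U T →ₗ⁅k⁆ U S := φ.toLieHom
    let f : T →ₗ[k] S :=
      { toFun := fun a => (F (ofOdd T a)).odd
        map_add' := fun a b => by simp
        map_smul' := fun c a => by simp }
    have hf : ∀ a, F (ofOdd T a) = ofOdd S (f a) := fun a =>
      eq_ofOdd_of_mem (φ.map_mem 1 _ (ofOdd_mem a))
    have htw : ∀ a, f (T.twist a) = S.twist (f a) := by
      intro a
      have h : F (U.twist T (ofOdd T a)) = U.twist S (F (ofOdd T a)) := φ.comm (ofOdd T a)
      rw [twist_ofOdd, hf, hf, twist_ofOdd] at h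
      exact congrArg U.odd h
    have hbr : ∀ a b c, S.str.bracket (f a) (f b) (f c) = f (T.str.bracket a b c) := by
      intro a b c
      have h := congrArg F (lie_lie_ofOdd a b c)
      rw [LieHom.map_lie, LieHom.map_lie, hf, hf, hf, hf, lie_lie_ofOdd] at h
      have h' := congrArg S.twist (congrArg U.odd h)
      simpa [← htw, untwist_D] using h'
    refine ⟨⟨f, hbr, htw, ?_⟩, TLZ2.Hom.ext (lieHom_ext fun a => ?_)⟩
    · rw [← T.regular.twist_eq, ← S.regular.twist_eq]
      exact htw
    · exact (map_ofOdd _ a).trans (hf a).symm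

/-! ### The odd part of a graded Lie algebra with automorphism -/

namespace TLZ2

variable {k : Type u} [CommRing k] (L : TLZ2.{u, v} k)

/-- The automorphism `α` restricted to the odd part. -/
def oddTwist : L.grading 1 →ₗ[k] L.grading 1 :=
  L.twist.toLinearEquiv.toLinearMap.restrict (L.twist_mem 1)

@[simp] lemma coe_oddTwist (a : L.grading 1) : (L.oddTwist a : L) = L.twist a := rfl

lemma oddTwist_bijective : Function.Bijective L.oddTwist := by
  constructor
  · intro a b h
    exact Subtype.ext (L.twist.injective (congrArg Subtype.val h))
  · intro b
    obtain ⟨x, hx⟩ := L.twist.surjective (b : L)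
    obtain ⟨y, hy, z, hz, rfl⟩ := exists_even_add_odd L.grading x
    -- The automorphism preserves both parts, so the even part of the preimage of `b` vanishes.
    have hy0 : L.twist y = 0 := by
      refine eq_zero_of_mem_even_of_mem_odd (𝓛 := L.grading) (L.twist_mem 0 y hy) ?_
      have h : L.twist y + L.twist z = b := (map_add L.twist y z).symm.trans hx
      rw [eq_sub_of_add_eq h]
      exact sub_mem b.2 (L.twist_mem 1 z hz)
    refine ⟨⟨z, hz⟩, Subtype.ext ?_⟩
    change L.twist z = b
    rw [← zero_add (L.twist z), ← hy0, ← map_add]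
    exact hx

/-- The triple bracket `[a, b, c] = α ⁅⁅a, b⁆, c⁆` on the odd part. -/
def oddBracket : L.grading 1 →ₗ[k] L.grading 1 →ₗ[k] L.grading 1 →ₗ[k] L.grading 1 :=
  LinearMap.mk₂ k
    (fun a b =>
      { toFun := fun c =>
          ⟨L.twist ⁅⁅(a : L), (b : L)⁆, (c : L)⁆,
            L.twist_mem 1 _ (lie_lie_odd_mem a.2 b.2 c.2)⟩
        map_add' := fun c d => by ext; simp
        map_smul' := fun r c => by ext; simp })
    (fun a a' b => by ext; simp)
    (fun r a b => by ext; simp)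
    (fun a b b' => by ext; simp)
    (fun r a b => by ext; simp)

lemma coe_oddBracket (a b c : L.grading 1) :
    (L.oddBracket a b c : L) = L.twist ⁅⁅(a : L), (b : L)⁆, (c : L)⁆ := rfl

/-- The odd part of a `ℤ₂`-graded Lie algebra with a graded automorphism, as a regular Hom-LTS. -/
def oddRLTS : RLTS.{u, v} k where
  carrier := L.grading 1
  str :=
    { bracket := L.oddBracket
      twist₁ := L.oddTwist
      twist₂ := L.oddTwist
      bracket_self := fun a b => Subtype.ext (by simp [coe_oddBracket])
      bracket_cyclic := fun a b c => Subtype.ext (by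
        simp only [Submodule.coe_add, coe_oddBracket, ← map_add, Submodule.coe_zero]
        rw [← lie_skew ⁅(a : L), (b : L)⁆, ← lie_skew ⁅(b : L), (c : L)⁆,
          ← lie_skew ⁅(c : L), (a : L)⁆, ← neg_add, ← neg_add,
          add_assoc, add_comm, lie_jacobi, neg_zero, map_zero])
      hom_nambu := fun a b c d e => Subtype.ext (by
        simp only [Submodule.coe_add, coe_oddBracket, coe_oddTwist, ← LieEquiv.map_lie, ← map_add]
        rw [leibniz_lie, leibniz_lie ⁅(a : L), (b : L)⁆ (c : L) (d : L), add_lie]) }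
  regular :=
    { twist_eq := rfl
      isHom := ⟨fun a b c => Subtype.ext (by
          simp only [coe_oddBracket, coe_oddTwist, LieEquiv.map_lie]), fun _ => rfl, fun _ => rfl⟩
      bijective := L.oddTwist_bijective }

/-- The inclusion of the odd part, as a linear map on the carrier of `oddRLTS`. -/
def oddIncl : L.oddRLTS →ₗ[k] L := (L.grading 1).subtype

lemma oddIncl_mem (a : L.oddRLTS) : L.oddIncl a ∈ L.grading 1 := Subtype.prop a

lemma oddIncl_injective : Function.Injective L.oddIncl := Subtype.val_injective

lemma oddIncl_twist (a : L.oddRLTS) : L.oddIncl (L.oddRLTS.twist a) = L.twist (L.oddIncl a) := rfl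

lemma lie_lie_oddIncl (a b c : L.oddRLTS) :
    ⁅⁅L.oddIncl a, L.oddIncl b⁆, L.oddIncl c⁆ =
      L.oddIncl (L.oddRLTS.untwist (L.oddRLTS.D a b) c) := by
  apply L.twist.injective
  change L.twist _ = L.twist _
  rw [← oddIncl_twist, untwist_D, LinearEquiv.apply_symm_apply]
  rfl

/-- The homomorphism `U(L₁) → L` extending the inclusion of the odd part. -/
def fromU : U L.oddRLTS →ₗ⁅k⁆ L := U.lift L.oddIncl L.lie_lie_oddIncl

lemma fromU_mem (i : ZMod 2) (p : U L.oddRLTS) (hp : p ∈ U.grading L.oddRLTS i) :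
    L.fromU p ∈ L.grading i :=
  U.lift_mem _ _ L.oddIncl_mem i p hp

@[simp] lemma fromU_ofOdd (a : L.oddRLTS) : L.fromU (ofOdd _ a) = L.oddIncl a :=
  U.lift_ofOdd _ _ a

lemma fromU_surjective (h : IsGeneratedByOdd L.grading) : Function.Surjective L.fromU := by
  rw [← LieHom.range_eq_top, eq_top_iff, ← h, LieSubalgebra.lieSpan_le]
  intro x hx
  exact ⟨ofOdd L.oddRLTS ⟨x, hx⟩, L.fromU_ofOdd _⟩

lemma odd_eq_zero_of_fromU_eq_zero {p : U L.oddRLTS} (hp : L.fromU p = 0) : p.odd = 0 := by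
  apply L.oddIncl_injective
  rw [map_zero]
  refine eq_zero_of_mem_even_of_mem_odd (𝓛 := L.grading) ?_ (L.oddIncl_mem _)
  rw [eq_neg_of_add_eq_zero_right (hp : _ + L.oddIncl p.odd = 0)]
  exact neg_mem (U.angleLift_mem _ _ L.oddIncl_mem _)

/-- An element of the kernel is even and acts trivially on the odd part, which generates. -/
lemma ker_fromU_le_center : L.fromU.ker ≤ LieAlgebra.center k (U L.oddRLTS) := by
  intro p hp
  have hp : L.fromU p = 0 := hp
  have hodd := L.odd_eq_zero_of_fromU_eq_zero hp
  have hmu : L.oddRLTS.untwist (L.oddRLTS.mu p.even) = 0 := by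
    apply LinearMap.ext
    intro c
    apply L.oddIncl_injective
    rw [← U.lie_angleLift L.oddIncl L.lie_lie_oddIncl]
    have h : U.angleLift L.oddIncl L.lie_lie_oddIncl p.even = 0 := by
      rw [fromU, U.lift_apply, hodd, map_zero, add_zero] at hp
      exact hp
    simp [h]
  have hbr : L.oddRLTS.angleBracket p.even = 0 := angle_ext fun a b => by
    simp [angleBracket_right, hmu]
  refine (LieModule.mem_maxTrivSubmodule ..).2 fun q => ?_
  rw [← lie_skew, neg_eq_zero]
  ext <;> simp [hodd, hmu, hbr]

/-- If `L` is centrally 0-closed and generated by its odd part, then `U(L₁) ≅ L`. -/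
def functorAObjOddIso (h : closedOddGenerated k L) :
    (functorA.{u, v} k).obj L.oddRLTS ≅ L :=
  have hs := h.1 (U L.oddRLTS) (U.grading L.oddRLTS) L.fromU L.fromU_mem
    (L.fromU_surjective h.2) L.ker_fromU_le_center
    fun _ hp => mem_grading_zero.2 (L.odd_eq_zero_of_fromU_eq_zero hp)
  let s : L →ₗ⁅k⁆ U L.oddRLTS := hs.choose
  have hsmem : ∀ i, ∀ x ∈ L.grading i, s x ∈ U.grading L.oddRLTS i := hs.choose_spec.1
  have hfs : ∀ x, L.fromU (s x) = x := hs.choose_spec.2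
  have hsf : ∀ p, s (L.fromU p) = p := by
    have : s.comp L.fromU = LieHom.id := lieHom_ext fun a => by
      have h1 := eq_ofOdd_of_mem (hsmem 1 _ (L.oddIncl_mem a))
      have h2 : L.fromU (s (L.oddIncl a)) = L.oddIncl a := hfs _
      rw [h1, fromU_ofOdd] at h2
      rw [LieHom.comp_apply, fromU_ofOdd, h1, L.oddIncl_injective h2]
      rfl
    exact LieHom.congr_fun this
  have hcomm : ∀ p, L.fromU (U.twist L.oddRLTS p) = L.twist (L.fromU p) := by
    have : L.fromU.comp (U.twist L.oddRLTS).toLieHom = L.twist.toLieHom.comp L.fromU :=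
      lieHom_ext fun a => by
        change L.fromU (U.twist L.oddRLTS _) = L.twist (L.fromU _)
        rw [twist_ofOdd, fromU_ofOdd, fromU_ofOdd, oddIncl_twist]
    exact LieHom.congr_fun this
  { hom := ⟨L.fromU, L.fromU_mem, hcomm⟩
    inv := ⟨s, hsmem, fun x => by
      change s (L.twist x) = U.twist L.oddRLTS (s x)
      rw [← hsf (U.twist L.oddRLTS (s x)), hcomm, hfs]⟩
    hom_inv_id := TLZ2.Hom.ext (LieHom.ext hsf)
    inv_hom_id := TLZ2.Hom.ext (LieHom.ext hfs) }

end TLZ2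

end

theorem theorem5p1 (k : Type u) [CommRing k] :
    (functorA.{u, v} k).Full ∧
    (functorA.{u, v} k).Faithful ∧
    ∃ h : ∀ T : RLTS.{u, v} k, TLZ2.closedOddGenerated k ((functorA.{u, v} k).obj T),
      ((TLZ2.closedOddGenerated.{u, v} k).lift (functorA.{u, v} k) h).IsEquivalence := by
  have hfull := functorA_full.{u, v} k
  have hfaithful := functorA_faithful.{u, v} k
  let P := TLZ2.closedOddGenerated.{u, v} k
  have h : ∀ T : RLTS.{u, v} k, P ((functorA k).obj T) :=
    fun T => ⟨RLTS.U.isCentrallyZeroClosed, RLTS.U.isGeneratedByOdd⟩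
  refine ⟨hfull, hfaithful, h, ?_⟩
  have : (P.lift (functorA k) h).EssSurj :=
    ⟨fun L => ⟨L.obj.oddRLTS, ⟨P.isoMk (L.obj.functorAObjOddIso L.property)⟩⟩⟩
  exact { full := inferInstance, faithful := inferInstance }
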